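/- **Setting.** Let $M\ge 1$ be an integer and let $\rho,q,\sigma>0$. Users $1,\dots,K$ have channel gains $\beta_1,\dots,\beta_K>0$. Let $\mathcal S\subseteq\{1,\dots,K\}$ be the set of users that send a given pilot, let $k\in\mathcal S$, and put $\alpha_{\mathcal S}=\sum_{i\in\mathcal S}\beta_i$. Let $h_i\sim\mathcal{CN}(0,\beta_i I_M)$ ($i=1,\dots,K$), $n\sim\mathcal{CN}(0,\sigma^2 I_M)$ and $\eta_k\sim\mathcal{CN}(0,\sigma^2)$ be mutually independent, where $\mathcal{CN}$ denotes circularly symmetric complex Gaussian laws. Put $$y=\sum_{i\in\mathcal S}\sqrt{\rho}\,h_i+n,\qquad \hat h=\frac{y}{\sqrt\rho},\qquad w=\sqrt q\,\frac{\hat h}{\|\hat h\|},\qquad z_k=h_k^{\mathrm H}w+\eta_k=z_{\Re}+\mathrm j z_{\Im}.$$ For $\alpha\ge\beta_k$ let $$\lambda_1=\frac{\rho q\beta_k^2}{\rho\alpha+\sigma^2},\qquad \lambda_2=\sigma^2+q\beta_k-\lambda_1,$$ $$f_1(x\,|\,\alpha)=\frac{e^{-\frac{x^2}{\lambda_2}\left(1-\frac{\lambda_1}{\lambda_1+\lambda_2}\right)}}{\Gamma(M)\lambda_1^M\sqrt{\pi\lambda_2}}\sum_{n=0}^{2M-1}\binom{2M-1}{n}\frac{\Gamma\left(\frac{n+1}{2}\right)+c_n(x)\,\gamma\left(\frac{n+1}{2},\frac{x^2}{\lambda_2}\frac{\lambda_1}{\lambda_1+\lambda_2}\right)}{\left(\frac{x}{\lambda_2}\right)^{n+1-2M}\left(\frac1{\lambda_1}+\frac1{\lambda_2}\right)^{2M-\frac{n+1}{2}}},$$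 $$f_2(y\,|\,\alpha)=\frac{1}{\sqrt{\pi\lambda_2}}\,e^{-y^2/\lambda_2},$$ where $c_n(x)=(-1)^n$ if $x>0$, $c_n(x)=-1$ if $x<0$, and $\gamma(s,x)=\int_0^x t^{s-1}e^{-t}\,dt$ is the lower incomplete gamma function; at $x=0$, $f_1$ is defined by its limit for $x\to0$, in which only the summand $n=2M-1$ survives. **Theorem.** 1. If $\alpha_{\mathcal S}=\alpha$, then $f_1(\cdot\,|\,\alpha)$ is the (continuous) probability density function of $z_{\Re}$, $f_2(\cdot\,|\,\alpha)$ is that of $z_{\Im}$, and $(x,y)\mapsto f_1(x\,|\,\alpha)f_2(y\,|\,\alpha)$ is that of $(z_{\Re},z_{\Im})$. 2. The maximum-likelihood estimate of $\alpha_{\mathcal S}$ from an observation $z_k=z_{\Re}+\mathrm jz_{\Im}$, that is, a maximizer over $\alpha\ge\beta_k$ of the continuous joint density of $(z_{\Re},z_{\Im})$ given $\alpha_{\mathcal S}=\alpha$, is $$\hat\alpha^{\mathrm{ML}}_{\mathcal S,k}=\operatorname*{arg\,max}_{\alpha\ge\beta_k}\; f_1(z_{\Re}\,|\,\alpha)\,f_2(z_{\Im}\,|\,\alpha),$$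 as an equality of (possibly empty) sets of maximizers, for every $z_k\in\mathbb C$. -/

import Mathlib

open MeasureTheory ProbabilityTheory

noncomputable section

namespace PilotContention

/-- The circularly symmetric complex Gaussian law `CN(0, v)` on `ℂ`: independent real and
imaginary parts, each `N(0, v / 2)`. -/
def complexGaussian (v : ℝ) : Measure ℂ :=
  ((gaussianReal 0 (v / 2).toNNReal).prod (gaussianReal 0 (v / 2).toNNReal)).map
    (fun p => (⟨p.1, p.2⟩ : ℂ))

/-- The law `CN(0, v I_M)` on `ℂ^M`: independent coordinates, each `CN(0, v)`. -/
def complexGaussianVec (M : ℕ) (v : ℝ) : Measure (EuclideanSpace ℂ (Fin M)) :=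
  (Measure.pi (fun _ : Fin M => complexGaussian v)).map (WithLp.toLp 2)

/-- The received uplink pilot signal `y = ∑_{i ∈ S} √ρ h_i + n` at the base station. -/
def uplinkSignal {M K : ℕ} (ρ : ℝ) (S : Finset (Fin K))
    (h : Fin K → EuclideanSpace ℂ (Fin M)) (n : EuclideanSpace ℂ (Fin M)) :
    EuclideanSpace ℂ (Fin M) :=
  ∑ i ∈ S, ((Real.sqrt ρ : ℝ) : ℂ) • h i + n

/-- The least-squares channel estimate `y / √ρ`. -/
def lsEstimate {M K : ℕ} (ρ : ℝ) (S : Finset (Fin K))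
    (h : Fin K → EuclideanSpace ℂ (Fin M)) (n : EuclideanSpace ℂ (Fin M)) :
    EuclideanSpace ℂ (Fin M) :=
  ((1 / Real.sqrt ρ : ℝ) : ℂ) • uplinkSignal ρ S h n

/-- The precoding vector `w = √q ĥ / ‖ĥ‖`, with `ĥ` the least-squares estimate and `‖·‖` the
Euclidean norm (the event `ĥ = 0` has probability zero). -/
def precoder {M K : ℕ} (ρ q : ℝ) (S : Finset (Fin K))
    (h : Fin K → EuclideanSpace ℂ (Fin M)) (n : EuclideanSpace ℂ (Fin M)) :
    EuclideanSpace ℂ (Fin M) :=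
  ((Real.sqrt q / ‖lsEstimate ρ S h n‖ : ℝ) : ℂ) • lsEstimate ρ S h n

/-- The received downlink pilot signal `z_k = h_kᴴ w + η_k` at user `k`
(the inner product is conjugate-linear in its first argument). -/
def receivedSignal {M K : ℕ} (ρ q : ℝ) (S : Finset (Fin K)) (k : Fin K)
    (h : Fin K → EuclideanSpace ℂ (Fin M)) (n : EuclideanSpace ℂ (Fin M)) (η : ℂ) : ℂ :=
  inner ℂ (h k) (precoder ρ q S h n) + η

/-- The random quantities of the model on a probability space: channels
`h_i ∼ CN(0, β_i I_M)`, base station noise `n ∼ CN(0, σ² I_M)` and user noise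
`η ∼ CN(0, σ²)`, all mutually independent. -/
structure IsRayleighModel {Ω : Type*} [MeasurableSpace Ω] (P : Measure Ω) {M K : ℕ}
    (σ : ℝ) (β : Fin K → ℝ) (h : Fin K → Ω → EuclideanSpace ℂ (Fin M))
    (n : Ω → EuclideanSpace ℂ (Fin M)) (η : Ω → ℂ) : Prop where
  law_channel : ∀ i, HasLaw (h i) (complexGaussianVec M (β i)) P
  law_noise : HasLaw n (complexGaussianVec M (σ ^ 2)) P
  law_userNoise : HasLaw η (complexGaussian (σ ^ 2)) P
  indep_channels_noise : iIndepFun (fun o : Option (Fin K) => o.elim n h) P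
  indep_userNoise : IndepFun (fun ω => (fun i => h i ω, n ω)) η P

/-- The law of `(Re z_k, Im z_k)` when the users in `S` send the pilot and the channel gains
are `β`, computed on the product probability space of all channels and noises. -/
def signalLaw (M : ℕ) {K : ℕ} (ρ q σ : ℝ) (β : Fin K → ℝ) (S : Finset (Fin K)) (k : Fin K) :
    Measure (ℝ × ℝ) :=
  (((Measure.pi (fun i => complexGaussianVec M (β i))).prod
      (complexGaussianVec M (σ ^ 2))).prod (complexGaussian (σ ^ 2))).map
    (fun p => ((receivedSignal ρ q S k p.1.1 p.1.2 p.2).re,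
      (receivedSignal ρ q S k p.1.1 p.1.2 p.2).im))

/-- `p` is the continuous probability density function of `μ` (with respect to Lebesgue
measure). On `ℝ` and `ℝ × ℝ` there is at most one such function. -/
def IsContinuousPDF {E : Type*} [MeasureSpace E] [TopologicalSpace E]
    (μ : Measure E) (p : E → ℝ) : Prop :=
  Continuous p ∧ (∀ x, 0 ≤ p x) ∧ μ = volume.withDensity (fun x => ENNReal.ofReal (p x))

/-- `L α` is the joint PDF of `(Re z_k, Im z_k)` given that the sum of the channel gains of
the users in `S` equals `α`, for a user `k ∈ S` with gain `b`: whatever the number of users,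
the set `S` and the gains are, subject to this. -/
def IsLikelihood (M : ℕ) (ρ q σ b : ℝ) (L : ℝ → ℝ × ℝ → ℝ) : Prop :=
  ∀ (K : ℕ) (β : Fin K → ℝ) (S : Finset (Fin K)) (k : Fin K),
    (∀ i, 0 < β i) → k ∈ S → β k = b →
      IsContinuousPDF (signalLaw M ρ q σ β S k) (L (∑ i ∈ S, β i))

/-- The set of maximizers of `F` over `A`. -/
def argmaxOn (A : Set ℝ) (F : ℝ → ℝ) : Set ℝ := {a | a ∈ A ∧ IsMaxOn F A a}

/-- The maximum likelihood estimates of the sum of the channel gains, at a user with gain `b`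
that observes `z`. -/
def mlEstimates (M : ℕ) (ρ q σ b : ℝ) (z : ℂ) : Set ℝ :=
  {a | ∃ L : ℝ → ℝ × ℝ → ℝ, IsLikelihood M ρ q σ b L ∧
    a ∈ argmaxOn (Set.Ici b) (fun α => L α (z.re, z.im))}

/-- The lower incomplete gamma function `γ(s, x)`. -/
def lowerGamma (s x : ℝ) : ℝ := ∫ t in (0 : ℝ)..x, t ^ (s - 1) * Real.exp (-t)

/-- `λ₁ = ρ q b² / (ρ α + σ²)`. -/
def lam1 (ρ q σ b α : ℝ) : ℝ := ρ * q * b ^ 2 / (ρ * α + σ ^ 2)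

/-- `λ₂ = σ² + q b - λ₁`. -/
def lam2 (ρ q σ b α : ℝ) : ℝ := σ ^ 2 + q * b - lam1 ρ q σ b α

/-- The sign `c_n(x)`: `(-1)^n` for `x > 0` and `-1` for `x < 0` (its value at `x = 0` is
immaterial, since it multiplies `γ(s, 0) = 0` there). -/
def signCoeff (n : ℕ) (x : ℝ) : ℝ := if 0 < x then (-1) ^ n else -1

/-- The density `f₁(x | α)`. The power of `x / λ₂` in the denominator has the integer exponent
`n + 1 - 2M ≤ 0`. At `x = 0` only the summand `n = 2M - 1`, with exponent `0`, is nonzero, so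
that the formula gives the limit for `x → 0`. -/
def f1 (M : ℕ) (ρ q σ b x α : ℝ) : ℝ :=
  let l₁ := lam1 ρ q σ b α
  let l₂ := lam2 ρ q σ b α
  Real.exp (-(x ^ 2 / l₂) * (1 - l₁ / (l₁ + l₂)))
      / (Real.Gamma M * l₁ ^ M * Real.sqrt (Real.pi * l₂)) *
    ∑ n ∈ Finset.range (2 * M), ((2 * M - 1).choose n : ℝ) *
      ((Real.Gamma (((n : ℝ) + 1) / 2) +
          signCoeff n x * lowerGamma (((n : ℝ) + 1) / 2) (x ^ 2 / l₂ * (l₁ / (l₁ + l₂)))) /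
        ((x / l₂) ^ ((n : ℤ) + 1 - 2 * (M : ℤ)) *
          (1 / l₁ + 1 / l₂) ^ (2 * (M : ℝ) - ((n : ℝ) + 1) / 2)))

/-- The density `f₂(y | α)`, which is that of `N(0, λ₂ / 2)`. -/
def f2 (ρ q σ b y α : ℝ) : ℝ :=
  let l₂ := lam2 ρ q σ b α
  1 / Real.sqrt (Real.pi * l₂) * Real.exp (-(y ^ 2 / l₂))

end PilotContention

end

/-! Per coordinate, the best linear estimate of `√q h_k` from `y` is `x = c y`, with `c` the
regression coefficient. Since all variables are jointly Gaussian, `x` and the residual `u = √q h_k -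
x` are independent, with laws `CN(0, λ₁ I)` and `CN(0, (q β_k - λ₁) I)`
(`map_scaledSignal_residual`). The precoder only sees the direction of `y`, which is that of `x`, so
`z_k = ‖x‖ + uᴴ x / ‖x‖ + η` (`receivedSignal_eq`). Given `x`, the middle term is an isotropic
Gaussian vector tested against a unit vector, so its law does not depend on `x`. Hence `z_k` is
`‖x‖` plus an independent `CN(0, λ₂)` variable (`map_norm_add_inner`): its imaginary part is `N(0,
λ₂ / 2)`, independent of its real part, which is `‖x‖` plus another `N(0, λ₂ / 2)`.

The density of `‖x‖` follows from polar coordinates in real dimension `2M` (`map_norm_of_charFun`).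
In its convolution with the Gaussian, completing the square, translating and expanding binomially
leaves half-line Gaussian moments, which are the gamma functions of `f₁`
(`integral_normDensity_mul_eq_f1`).

For the estimate, continuous densities are unique pointwise, and every `α ≥ b` is attained by one or
two users. Every likelihood therefore equals `f₁ f₂` on `α ≥ b`, and the sets of maximizers
coincide. -/

/-! ### Isotropic complex Gaussian laws and their characteristic functions -/

open Complex in
theorem charFun_complexGaussian {v : ℝ} (hv : 0 ≤ v) (t : ℂ) :
    charFun (PilotContention.complexGaussian v) t = cexp (-(v / 4 * ‖t‖ ^ 2 : ℝ)) := by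
  have hmeas : Measurable (fun p : ℝ × ℝ => (⟨p.1, p.2⟩ : ℂ)) :=
    Complex.measurableEquivRealProd.symm.measurable
  rw [PilotContention.complexGaussian, charFun_apply,
    integral_map hmeas.aemeasurable (by fun_prop)]
  have h (p : ℝ × ℝ) : cexp ((inner ℝ (⟨p.1, p.2⟩ : ℂ) t : ℝ) * I) =
      cexp (t.re * p.1 * I) * cexp (t.im * p.2 * I) := by
    rw [← Complex.exp_add, Complex.inner]
    congr 1
    simp
    ring
  simp_rw [h]
  rw [integral_prod_mul (fun x : ℝ => cexp (t.re * x * I)) (fun x : ℝ => cexp (t.im * x * I)),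
    ← charFun_apply_real, ← charFun_apply_real, charFun_gaussianReal, charFun_gaussianReal,
    ← Complex.exp_add, Complex.sq_norm, Complex.normSq_apply]
  congr 1
  have : (((v / 2).toNNReal : ℝ) : ℂ) = v / 2 := by
    rw [Real.coe_toNNReal _ (by positivity)]; simp
  simp only [this]
  push_cast
  ring

instance isProbabilityMeasure_complexGaussian (v : ℝ) :
    IsProbabilityMeasure (PilotContention.complexGaussian v) :=
  Measure.isProbabilityMeasure_map
    Complex.measurableEquivRealProd.symm.measurable.aemeasurable

instance isProbabilityMeasure_complexGaussianVec (M : ℕ) (v : ℝ) :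
    IsProbabilityMeasure (PilotContention.complexGaussianVec M v) :=
  Measure.isProbabilityMeasure_map (by fun_prop)

open Complex in
theorem charFun_complexGaussianVec (M : ℕ) {v : ℝ} (hv : 0 ≤ v)
    (t : EuclideanSpace ℂ (Fin M)) :
    charFun (PilotContention.complexGaussianVec M v) t = cexp (-(v / 4 * ‖t‖ ^ 2 : ℝ)) := by
  have h := charFun_pi (μ := fun _ : Fin M => PilotContention.complexGaussian v) t
  rw [PilotContention.complexGaussianVec]
  simp_rw [charFun_complexGaussian hv, ← Complex.exp_sum] at h
  convert h using 2
  rw [EuclideanSpace.norm_sq_eq, Finset.mul_sum]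
  push_cast
  rw [Finset.sum_neg_distrib]

theorem gaussianExp_integrable {V : Type*} [NormedAddCommGroup V] [InnerProductSpace ℝ V]
    [FiniteDimensional ℝ V] [MeasurableSpace V] [BorelSpace V] {v : ℝ} (hv : 0 < v) :
    Integrable (fun x : V => Real.exp (-(‖x‖ ^ 2 / v))) := by
  have h := (GaussianFourier.integrable_cexp_neg_mul_sq_norm_add (V := V) (b := (1 / v : ℝ))
    (by simpa using hv) 0 0).re
  convert h using 2 with x
  have : -((1 / v : ℝ) : ℂ) * (‖x‖ : ℂ) ^ 2 + 0 * ((inner ℝ (0 : V) x : ℝ) : ℂ) =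
    ((-(‖x‖ ^ 2 / v) : ℝ) : ℂ) := by push_cast; ring
  rw [this, ← Complex.ofReal_exp]
  exact (Complex.ofReal_re _).symm

open Complex in
/-- A finite measure with the characteristic function of an isotropic Gaussian law has the
Gaussian density, up to normalization. -/
theorem exists_density_of_charFun {V : Type*} [NormedAddCommGroup V] [InnerProductSpace ℝ V]
    [FiniteDimensional ℝ V] [MeasurableSpace V] [BorelSpace V] {v : ℝ} (hv : 0 < v)
    (μ : Measure V) [IsFiniteMeasure μ]
    (hμ : ∀ t, charFun μ t = cexp (-(v / 4 * ‖t‖ ^ 2 : ℝ))) :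
    ∃ c : ℝ, 0 < c ∧
      μ = volume.withDensity (fun x => ENNReal.ofReal (c * Real.exp (-(‖x‖ ^ 2 / v)))) := by
  have hpv : 0 < Real.pi * v := by positivity
  set c : ℝ := ((Real.pi * v) ^ (Module.finrank ℝ V / 2 : ℝ))⁻¹ with hc
  have hc0 : 0 < c := by positivity
  have hint := (gaussianExp_integrable (V := V) hv).const_mul c
  have : IsFiniteMeasure
      (volume.withDensity (fun x : V => ENNReal.ofReal (c * Real.exp (-(‖x‖ ^ 2 / v))))) :=
    isFiniteMeasure_withDensity_ofReal hint.2
  refine ⟨c, hc0, Measure.ext_of_charFun ?_⟩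
  ext t
  rw [hμ, charFun_apply, integral_withDensity_eq_integral_toReal_smul (by fun_prop) (by simp)]
  have h1 (x : V) : (ENNReal.ofReal (c * Real.exp (-(‖x‖ ^ 2 / v)))).toReal •
      cexp ((inner ℝ x t : ℝ) * I) =
      c * cexp (-((1 / v : ℝ) : ℂ) * (‖x‖ : ℂ) ^ 2 + I * (inner ℝ t x : ℝ)) := by
    rw [ENNReal.toReal_ofReal (by positivity), Complex.real_smul, Complex.exp_add,
      real_inner_comm]
    push_cast
    rw [mul_assoc]
    ring_nf
  simp_rw [h1]
  rw [integral_const_mul, GaussianFourier.integral_cexp_neg_mul_sq_norm_add (by simpa using hv)]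
  have h2 : ((Real.pi : ℂ) / ((1 / v : ℝ) : ℂ)) ^ (Module.finrank ℝ V / 2 : ℂ) =
      (((Real.pi * v) ^ (Module.finrank ℝ V / 2 : ℝ) : ℝ) : ℂ) := by
    rw [Complex.ofReal_cpow hpv.le]
    push_cast
    congr 1
    field_simp
  rw [h2, ← mul_assoc, ← Complex.ofReal_mul, hc, inv_mul_cancel₀ (by positivity)]
  simp only [ofReal_one, one_mul, I_sq]
  congr 1
  push_cast
  have : (v : ℂ) ≠ 0 := by exact_mod_cast hv.ne'
  field_simp

/-! ### The norm of an isotropic Gaussian vector -/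

/-- The density of the norm of a complex Gaussian vector. -/
noncomputable def normDensity (M : ℕ) (v r : ℝ) : ℝ :=
  2 * r ^ (2 * M - 1) * Real.exp (-(r ^ 2 / v)) / (Real.Gamma M * v ^ M)

theorem integral_pow_mul_exp_neg_sq_div {M : ℕ} (hM : 1 ≤ M) {v : ℝ} (hv : 0 < v) :
    ∫ r in Set.Ioi (0 : ℝ), r ^ (2 * M - 1) * Real.exp (-(r ^ 2 / v)) =
      Real.Gamma M * v ^ M / 2 := by
  have h := integral_rpow_mul_exp_neg_mul_rpow (p := 2) (q := (2 * M - 1 : ℕ)) (b := 1 / v)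
    (by norm_num) (by have : (0 : ℝ) ≤ ((2 * M - 1 : ℕ) : ℝ) := by positivity
                      linarith) (by positivity)
  have hcast : ((2 * M - 1 : ℕ) : ℝ) = 2 * M - 1 := by
    rw [Nat.cast_sub (by omega)]; push_cast; ring
  have e : ((2 * M - 1 : ℕ) : ℝ) + 1 = 2 * M := by rw [hcast]; ring
  rw [e, neg_div, mul_div_cancel_left₀ _ (two_ne_zero' ℝ)] at h
  rw [show Real.Gamma M * v ^ M / 2 = (1 / v) ^ (-(M : ℝ)) * (1 / 2) * Real.Gamma M by
    rw [one_div v, Real.inv_rpow hv.le, Real.rpow_neg hv.le, inv_inv, Real.rpow_natCast]; ring,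
    ← h]
  refine setIntegral_congr_fun measurableSet_Ioi fun r hr => ?_
  simp only [Real.rpow_natCast, Real.rpow_two]
  ring_nf

theorem integrableOn_normDensity {M : ℕ} (hM : 1 ≤ M) {v : ℝ} (hv : 0 < v) :
    IntegrableOn (normDensity M v) (Set.Ioi 0) := by
  have hG : 0 < Real.Gamma M := Real.Gamma_pos_of_pos (by exact_mod_cast hM)
  have : Integrable (fun r : ℝ => r ^ (2 * M - 1) * Real.exp (-(r ^ 2 / v)))
      (volume.restrict (Set.Ioi 0)) := by
    -- The Bochner integral of a non-integrable function is zero, so the nonzero value already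
    -- computed gives integrability.
    refine .of_integral_ne_zero ?_
    rw [integral_pow_mul_exp_neg_sq_div hM hv]; positivity
  refine (this.const_mul (2 / (Real.Gamma M * v ^ M))).congr (.of_forall fun r => ?_)
  simp only [normDensity]; ring

theorem normDensity_nonneg {M : ℕ} {v : ℝ} (hv : 0 < v) {r : ℝ} (hr : 0 ≤ r) :
    0 ≤ normDensity M v r := by
  have hG : 0 ≤ Real.Gamma M := Real.Gamma_nonneg_of_nonneg (by positivity)
  rw [normDensity]; positivity

/-- Polar coordinates turn a radial density in dimension `2M` into a multiple of `r ^ (2M - 1)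
exp(-r² / v)`. The multiple is recovered from total mass one, so neither the Gaussian constant nor
the volume of the unit ball has to be evaluated. -/
theorem map_norm_of_charFun {V : Type*} [NormedAddCommGroup V] [InnerProductSpace ℝ V]
    [FiniteDimensional ℝ V] [MeasurableSpace V] [BorelSpace V] {M : ℕ} (hM : 1 ≤ M)
    (hdim : Module.finrank ℝ V = 2 * M) {v : ℝ} (hv : 0 < v)
    (μ : Measure V) [IsProbabilityMeasure μ]
    (hμ : ∀ t, charFun μ t = Complex.exp (-(v / 4 * ‖t‖ ^ 2 : ℝ))) :
    μ.map (fun x => ‖x‖) =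
      (volume.restrict (Set.Ioi 0)).withDensity (fun r => ENNReal.ofReal (normDensity M v r)) := by
  obtain ⟨c, hc, hd⟩ := exists_density_of_charFun hv μ hμ
  have : Nontrivial V := Module.nontrivial_of_finrank_pos (R := ℝ) (by omega)
  set K : ℝ := (2 * M : ℕ) * volume.real (Metric.ball (0 : V) 1) * c with hK
  have key (A : Set ℝ) (hA : MeasurableSet A) : (μ.map (fun x => ‖x‖)).real A =
      K * ∫ r in Set.Ioi (0 : ℝ), A.indicator
        (fun r => r ^ (2 * M - 1) * Real.exp (-(r ^ 2 / v))) r := by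
    rw [map_measureReal_apply (by fun_prop) hA, ← integral_indicator_one (by measurability), hd,
      integral_withDensity_eq_integral_toReal_smul (by fun_prop) (by simp)]
    have h1 (x : V) : (ENNReal.ofReal (c * Real.exp (-(‖x‖ ^ 2 / v)))).toReal •
        ((fun x : V => ‖x‖) ⁻¹' A).indicator (1 : V → ℝ) x =
        (fun r : ℝ => A.indicator (fun r => c * Real.exp (-(r ^ 2 / v))) r) ‖x‖ := by
      rw [ENNReal.toReal_ofReal (by positivity)]
      by_cases h : ‖x‖ ∈ A <;> simp [h]
    simp_rw [h1]
    rw [integral_fun_norm_addHaar volume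
      (fun r : ℝ => A.indicator (fun r => c * Real.exp (-(r ^ 2 / v))) r), hdim, hK]
    simp only [nsmul_eq_mul, smul_eq_mul]
    rw [mul_assoc, mul_assoc]
    congr 2
    rw [← integral_const_mul]
    congr 1
    ext r
    by_cases h : r ∈ A <;> (simp [h]; try ring)
  have hprob : IsProbabilityMeasure (μ.map (fun x => ‖x‖)) :=
    Measure.isProbabilityMeasure_map (by fun_prop)
  -- Total mass one determines `K`.
  have hnorm := key Set.univ .univ
  simp only [probReal_univ, Set.indicator_univ] at hnorm
  rw [integral_pow_mul_exp_neg_sq_div hM hv] at hnorm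
  have hG : 0 < Real.Gamma M := Real.Gamma_pos_of_pos (by exact_mod_cast hM)
  have hKv : K = 2 / (Real.Gamma M * v ^ M) := by
    field_simp at hnorm ⊢; linarith
  have hint := integrableOn_normDensity hM hv
  ext A hA
  rw [withDensity_apply _ hA, ← ofReal_integral_eq_lintegral_ofReal (Integrable.restrict hint)
    (ae_restrict_of_ae ((ae_restrict_mem measurableSet_Ioi).mono fun r hr => ?_)),
    ← integral_indicator hA, ← ofReal_measureReal, key A hA, hKv, ← integral_const_mul]
  · congr 2
    ext r
    by_cases h : r ∈ A <;> simp [h, normDensity]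
    ring
  · exact normDensity_nonneg hv (le_of_lt hr)

/-! ### Half-line Gaussian moments and the incomplete gamma function -/

theorem two_mul_integral_pow_mul_exp_Ioi {A : ℝ} (hA : 0 < A) (n : ℕ) :
    2 * ∫ u in Set.Ioi (0 : ℝ), u ^ n * Real.exp (-(A * u ^ 2)) =
      A ^ (-(((n : ℝ) + 1) / 2)) * Real.Gamma (((n : ℝ) + 1) / 2) := by
  have h := integral_rpow_mul_exp_neg_mul_rpow (p := 2) (q := n) (b := A)
    (by norm_num) (by have : (0 : ℝ) ≤ n := by positivity
                      linarith) hA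
  have e : ∫ u in Set.Ioi (0 : ℝ), u ^ n * Real.exp (-(A * u ^ 2)) =
      ∫ u in Set.Ioi (0 : ℝ), u ^ (n : ℝ) * Real.exp (-A * u ^ (2 : ℝ)) := by
    refine setIntegral_congr_fun measurableSet_Ioi fun r hr => ?_
    simp only [Real.rpow_natCast, Real.rpow_two, neg_mul]
  rw [e, h, neg_div]
  ring

/-- Substitute `t = A u²`. -/
theorem two_mul_integral_pow_mul_exp {A : ℝ} (hA : 0 < A) (n : ℕ) {a : ℝ} (ha : 0 ≤ a) :
    2 * ∫ u in (0 : ℝ)..a, u ^ n * Real.exp (-(A * u ^ 2)) =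
      A ^ (-(((n : ℝ) + 1) / 2)) * PilotContention.lowerGamma (((n : ℝ) + 1) / 2) (A * a ^ 2) := by
  set s : ℝ := ((n : ℝ) + 1) / 2 with hs
  have hs0 : 0 < s := by positivity
  have hAs : 0 < A ^ s := Real.rpow_pos_of_pos hA s
  have hcomp (u : ℝ) (hu : 0 < u) :
      (A * u ^ 2) ^ (s - 1) * Real.exp (-(A * u ^ 2)) * (A * (2 * u)) =
        2 * A ^ s * (u ^ n * Real.exp (-(A * u ^ 2))) := by
    have h1 : (A * u ^ 2) ^ (s - 1) * (A * u ^ 2) = A ^ s * (u ^ n * u) := by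
      rw [← Real.rpow_add_one (by positivity), sub_add_cancel,
        Real.mul_rpow hA.le (by positivity), ← Real.rpow_natCast u 2, ← Real.rpow_mul hu.le,
        show ((2 : ℕ) : ℝ) * s = n + 1 by rw [hs]; push_cast; ring,
        Real.rpow_add_one hu.ne', Real.rpow_natCast]
    -- The extra factor `u` completes the exponent `s - 1` to `s`; it is cancelled afterwards.
    have h2 : u * ((A * u ^ 2) ^ (s - 1) * Real.exp (-(A * u ^ 2)) * (A * (2 * u))) =
        u * (2 * A ^ s * (u ^ n * Real.exp (-(A * u ^ 2)))) := by
      linear_combination 2 * Real.exp (-(A * u ^ 2)) * h1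
    exact mul_left_cancel₀ hu.ne' h2
  have himg : (fun u : ℝ => A * u ^ 2) '' Set.uIcc 0 a ⊆ Set.uIcc 0 (A * a ^ 2) := by
    rintro _ ⟨u, hu, rfl⟩
    rw [Set.uIcc_of_le ha] at hu
    rw [Set.uIcc_of_le (by positivity)]
    have : 0 ≤ u := hu.1
    exact ⟨by positivity, mul_le_mul_of_nonneg_left (pow_le_pow_left₀ hu.1 hu.2 2) hA.le⟩
  have hcv := intervalIntegral.integral_comp_mul_deriv''' (a := 0) (b := a)
    (f := fun u => A * u ^ 2) (f' := fun u => A * (2 * u))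
    (g := fun t => t ^ (s - 1) * Real.exp (-t)) (by fun_prop)
    (fun x _ => by
      simpa using ((hasDerivAt_pow 2 x).const_mul A).hasDerivWithinAt)
    (by
      rintro _ ⟨u, hu, rfl⟩
      rw [min_eq_left ha] at hu
      -- For `n = 0` the integrand `t ^ (s - 1)` is singular at `0`, but continuity is only required
      -- over the open interval.
      have h0 : 0 < u := hu.1
      have : A * u ^ 2 ≠ 0 := by positivity
      refine ContinuousAt.continuousWithinAt ?_
      exact (Real.continuousAt_rpow_const _ _ (.inl this)).mul (by fun_prop))
    (by
      refine IntegrableOn.mono_set ?_ himg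
      rw [Set.uIcc_of_le (by positivity), integrableOn_Icc_iff_integrableOn_Ioc]
      refine IntegrableOn.mono_set ?_ Set.Ioc_subset_Ioi_self
      simpa only [mul_comm] using Real.GammaIntegral_convergent hs0)
    (by
      rw [Set.uIcc_of_le ha, integrableOn_Icc_iff_integrableOn_Ioc]
      refine IntegrableOn.congr_fun (f := fun u => 2 * A ^ s * (u ^ n * Real.exp (-(A * u ^ 2))))
        ?_ (fun u hu => (hcomp u hu.1).symm) measurableSet_Ioc
      exact (Continuous.integrableOn_Icc (by fun_prop)).mono_set Set.Ioc_subset_Icc_self)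
  simp only [Function.comp, zero_pow two_ne_zero, mul_zero] at hcv
  have hcongr : ∫ u in (0 : ℝ)..a,
      (A * u ^ 2) ^ (s - 1) * Real.exp (-(A * u ^ 2)) * (A * (2 * u)) =
      ∫ u in (0 : ℝ)..a, 2 * A ^ s * (u ^ n * Real.exp (-(A * u ^ 2))) := by
    refine intervalIntegral.integral_congr_ae (.of_forall fun u hu => ?_)
    rw [Set.uIoc_of_le ha] at hu
    exact hcomp u hu.1
  rw [PilotContention.lowerGamma, ← hcv, Real.rpow_neg hA.le, hcongr,
    intervalIntegral.integral_const_mul]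
  field_simp

theorem integrable_pow_mul_exp {A : ℝ} (hA : 0 < A) (n : ℕ) :
    Integrable fun u : ℝ => u ^ n * Real.exp (-(A * u ^ 2)) := by
  have h := integrable_rpow_mul_exp_neg_mul_sq hA (s := n)
    (by have : (0 : ℝ) ≤ n := by positivity
        linarith)
  simpa only [Real.rpow_natCast, neg_mul] using h

/-- Split at `0`. For `m > 0` the piece over `(-m, 0)` is added, and reflecting it gives the parity
sign `(-1)^n`; for `m ≤ 0` the piece over `(0, -m)` is subtracted, with sign `-1` for every `n`.
This is the origin of `c_n`. -/
theorem two_mul_integral_pow_mul_exp_Ioi_neg {A : ℝ} (hA : 0 < A) (n : ℕ) (m : ℝ) :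
    2 * ∫ u in Set.Ioi (-m), u ^ n * Real.exp (-(A * u ^ 2)) =
      A ^ (-(((n : ℝ) + 1) / 2)) * (Real.Gamma (((n : ℝ) + 1) / 2) +
        PilotContention.signCoeff n m *
          PilotContention.lowerGamma (((n : ℝ) + 1) / 2) (A * m ^ 2)) := by
  have hint := integrable_pow_mul_exp hA n
  rw [← intervalIntegral.integral_interval_add_Ioi (b := 0) hint.integrableOn hint.integrableOn,
    mul_add, two_mul_integral_pow_mul_exp_Ioi hA, mul_add, add_comm]
  congr 1
  rcases lt_or_ge 0 m with hm | hm
  · rw [PilotContention.signCoeff, if_pos hm, mul_left_comm,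
      ← two_mul_integral_pow_mul_exp hA n hm.le, mul_left_comm]
    congr 1
    have := intervalIntegral.integral_comp_neg (a := 0) (b := m)
      (fun u : ℝ => u ^ n * Real.exp (-(A * u ^ 2)))
    rw [neg_zero] at this
    rw [← this, ← intervalIntegral.integral_const_mul]
    congr 1
    ext u
    rw [neg_pow, neg_sq]
    ring
  · rw [PilotContention.signCoeff, if_neg hm.not_gt, ← neg_sq m, mul_left_comm,
      ← two_mul_integral_pow_mul_exp hA n (neg_nonneg.2 hm), intervalIntegral.integral_symm]
    ring

/-- Put `r = u + m` and expand `(u + m) ^ N`. -/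
theorem two_mul_integral_pow_mul_exp_sub {A : ℝ} (hA : 0 < A) (N : ℕ) (m : ℝ) :
    ∫ r in Set.Ioi (0 : ℝ), 2 * r ^ N * Real.exp (-(A * (r - m) ^ 2)) =
      ∑ n ∈ Finset.range (N + 1), (N.choose n : ℝ) * (m ^ (N - n) *
        (A ^ (-(((n : ℝ) + 1) / 2)) * (Real.Gamma (((n : ℝ) + 1) / 2) +
        PilotContention.signCoeff n m *
          PilotContention.lowerGamma (((n : ℝ) + 1) / 2) (A * m ^ 2)))) := by
  have htr := (measurePreserving_add_right (volume : Measure ℝ) m).setIntegral_preimage_emb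
    (MeasurableEquiv.addRight m).measurableEmbedding
    (fun r => 2 * r ^ N * Real.exp (-(A * (r - m) ^ 2))) (Set.Ioi 0)
  have hpre : (fun x => x + m) ⁻¹' Set.Ioi (0 : ℝ) = Set.Ioi (-m) := by
    ext x; simp [neg_lt_iff_pos_add]
  rw [hpre] at htr
  rw [← htr]
  simp_rw [← two_mul_integral_pow_mul_exp_Ioi_neg hA, ← integral_const_mul]
  rw [← integral_finsetSum]
  · congr 1
    ext u
    rw [add_sub_cancel_right, add_pow, Finset.mul_sum, Finset.sum_mul]
    refine Finset.sum_congr rfl fun n _ => ?_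
    ring
  · intro n _
    exact (((((integrable_pow_mul_exp hA n).const_mul 2).const_mul _).const_mul _).integrableOn)

/-! ### Convolution of the norm density with a Gaussian -/

/-- The density of `N(0, w / 2)`. -/
noncomputable def centeredDensity (w y : ℝ) : ℝ :=
  1 / Real.sqrt (Real.pi * w) * Real.exp (-(y ^ 2 / w))

/-- Completing the square, `r² / l₁ + (x - r)² / l₂ = A (r - m)² + x² / (l₁ + l₂)` with `A = 1 / l₁
+ 1 / l₂` and `m = x / (l₂ A)`. -/
theorem integral_normDensity_mul_eq_f1 {M : ℕ} (hM : 1 ≤ M) {ρ q σ b α : ℝ}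
    (h₁ : 0 < PilotContention.lam1 ρ q σ b α) (h₂ : 0 < PilotContention.lam2 ρ q σ b α) (x : ℝ) :
    ∫ r in Set.Ioi (0 : ℝ), normDensity M (PilotContention.lam1 ρ q σ b α) r *
        centeredDensity (PilotContention.lam2 ρ q σ b α) (x - r) =
      PilotContention.f1 M ρ q σ b x α := by
  simp only [PilotContention.f1]
  generalize PilotContention.lam1 ρ q σ b α = l₁ at *
  generalize PilotContention.lam2 ρ q σ b α = l₂ at *
  set A : ℝ := 1 / l₁ + 1 / l₂ with hAdef
  have hA : 0 < A := by positivity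
  set m : ℝ := x / l₂ / A with hm
  set C : ℝ := Real.exp (-(x ^ 2 / l₂) * (1 - l₁ / (l₁ + l₂))) /
    (Real.Gamma M * l₁ ^ M * Real.sqrt (Real.pi * l₂)) with hC
  have hAm : x ^ 2 / l₂ * (l₁ / (l₁ + l₂)) = A * m ^ 2 := by
    rw [hm, hAdef]; field_simp; ring
  have hG : 0 < Real.Gamma M := Real.Gamma_pos_of_pos (by exact_mod_cast hM)
  have hS : 0 < Real.sqrt (Real.pi * l₂) := by have := Real.pi_pos; positivity
  have hfun (r : ℝ) : normDensity M l₁ r * centeredDensity l₂ (x - r) =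
      C * (2 * r ^ (2 * M - 1) * Real.exp (-(A * (r - m) ^ 2))) := by
    have he : Real.exp (-(r ^ 2 / l₁)) * Real.exp (-((x - r) ^ 2 / l₂)) =
        Real.exp (-(x ^ 2 / l₂) * (1 - l₁ / (l₁ + l₂))) * Real.exp (-(A * (r - m) ^ 2)) := by
      rw [← Real.exp_add, ← Real.exp_add]
      congr 1
      rw [hm, hAdef]; field_simp; ring
    rw [normDensity, centeredDensity, hC]
    linear_combination 2 * r ^ (2 * M - 1) / (Real.Gamma M * l₁ ^ M * Real.sqrt (Real.pi * l₂)) * he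
  simp_rw [hfun]
  rw [integral_const_mul, two_mul_integral_pow_mul_exp_sub hA, hAm]
  congr 1
  refine Finset.sum_congr (by congr 1; omega) fun n hn => ?_
  have hn' : n ≤ 2 * M - 1 := by rw [Finset.mem_range] at hn; omega
  have hsign : PilotContention.signCoeff n m = PilotContention.signCoeff n x := by
    have : 0 < m ↔ 0 < x := by rw [hm, div_pos_iff_of_pos_right hA, div_pos_iff_of_pos_right h₂]
    simp only [PilotContention.signCoeff, this]
  rw [hsign]
  congr 1
  -- Natural subtraction is exact because `n ≤ 2M - 1`. The identity also holds at `x = 0`, where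
  -- division by zero kills every summand except `n = 2M - 1`, whose power is `0 ^ 0 = 1`.
  have hz : (x / l₂) ^ ((n : ℤ) + 1 - 2 * (M : ℤ)) = ((x / l₂) ^ (2 * M - 1 - n))⁻¹ := by
    rw [← zpow_natCast, ← zpow_neg]
    congr 1
    omega
  have hp : A ^ (2 * (M : ℝ) - ((n : ℝ) + 1) / 2) =
      A ^ (2 * M - 1 - n) * A ^ (((n : ℝ) + 1) / 2) := by
    rw [← Real.rpow_natCast, ← Real.rpow_add hA]
    congr 1
    rw [Nat.cast_sub hn', Nat.cast_sub (by omega)]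
    push_cast
    ring
  generalize Real.Gamma (((n : ℝ) + 1) / 2) + _ = G
  rw [hz, hp, Real.rpow_neg hA.le, hm, div_pow (x / l₂), div_eq_mul_inv G, mul_inv, mul_inv,
    inv_inv]
  ring

theorem centeredDensity_nonneg (w y : ℝ) : 0 ≤ centeredDensity w y := by
  rw [centeredDensity]; positivity

theorem continuous_centeredDensity (w : ℝ) : Continuous (centeredDensity w) := by
  unfold centeredDensity; fun_prop

theorem centeredDensity_le {w : ℝ} (hw : 0 < w) (y : ℝ) :
    centeredDensity w y ≤ 1 / Real.sqrt (Real.pi * w) := by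
  rw [centeredDensity]
  refine mul_le_of_le_one_right (by positivity) (Real.exp_le_one_iff.2 ?_)
  have : 0 ≤ y ^ 2 / w := by positivity
  linarith

theorem gaussianReal_eq_withDensity_centeredDensity {w : ℝ} (hw : 0 < w) :
    gaussianReal 0 (w / 2).toNNReal =
      volume.withDensity (fun y => ENNReal.ofReal (centeredDensity w y)) := by
  rw [gaussianReal_of_var_ne_zero _ (by simpa using hw)]
  congr 1
  ext y
  rw [gaussianPDF, gaussianPDFReal, Real.coe_toNNReal _ (by positivity), centeredDensity,
    one_div]
  congr 4
  · ring
  · field_simp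
    ring

theorem integrableOn_normDensity_mul_centeredDensity {M : ℕ} (hM : 1 ≤ M) {v w : ℝ} (hv : 0 < v)
    (hw : 0 < w) (x : ℝ) :
    IntegrableOn (fun r => normDensity M v r * centeredDensity w (x - r)) (Set.Ioi 0) := by
  refine (integrableOn_normDensity hM hv).mul_bdd (c := 1 / Real.sqrt (Real.pi * w))
    ((continuous_centeredDensity w).comp (by fun_prop)).aestronglyMeasurable
    (.of_forall fun r => ?_)
  rw [Real.norm_of_nonneg (centeredDensity_nonneg _ _)]
  exact centeredDensity_le hw _

theorem continuous_normDensity (M : ℕ) (v : ℝ) : Continuous (normDensity M v) := by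
  unfold normDensity; fun_prop

theorem continuous_integral_normDensity_mul {M : ℕ} (hM : 1 ≤ M) {v w : ℝ} (hv : 0 < v)
    (hw : 0 < w) :
    Continuous fun x => ∫ r in Set.Ioi (0 : ℝ), normDensity M v r * centeredDensity w (x - r) := by
  refine continuous_of_dominated (bound := fun r => ‖normDensity M v r‖ *
    (1 / Real.sqrt (Real.pi * w)))
    (fun x => (integrableOn_normDensity_mul_centeredDensity hM hv hw x).aestronglyMeasurable)
    (fun x => .of_forall fun r => ?_) ((integrableOn_normDensity hM hv).norm.mul_const _)
    (.of_forall fun r => continuous_const.mul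
      ((continuous_centeredDensity w).comp (by fun_prop)))
  rw [norm_mul, Real.norm_of_nonneg (centeredDensity_nonneg _ _)]
  exact mul_le_mul_of_nonneg_left (centeredDensity_le hw _) (norm_nonneg _)

theorem integral_normDensity_mul_nonneg {M : ℕ} {v w : ℝ} (hv : 0 < v) (x : ℝ) :
    0 ≤ ∫ r in Set.Ioi (0 : ℝ), normDensity M v r * centeredDensity w (x - r) :=
  setIntegral_nonneg measurableSet_Ioi fun _ hr =>
    mul_nonneg (normDensity_nonneg hv (le_of_lt hr)) (centeredDensity_nonneg _ _)

theorem normDensity_conv_gaussianReal {M : ℕ} (hM : 1 ≤ M) {v w : ℝ} (hv : 0 < v)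
    (hw : 0 < w) :
    (volume.restrict (Set.Ioi 0)).withDensity (fun r => ENNReal.ofReal (normDensity M v r)) ∗
        gaussianReal 0 (w / 2).toNNReal =
      volume.withDensity (fun x => ENNReal.ofReal
        (∫ r in Set.Ioi (0 : ℝ), normDensity M v r * centeredDensity w (x - r))) := by
  have hc := (continuous_normDensity M v).measurable
  have hd := (continuous_centeredDensity w).measurable
  rw [gaussianReal_eq_withDensity_centeredDensity hw, ← withDensity_indicator measurableSet_Ioi,
    conv_withDensity_eq_lconvolution (hc.ennreal_ofReal.indicator measurableSet_Ioi)
      hd.ennreal_ofReal]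
  congr 1
  ext x
  rw [lconvolution_def, ofReal_integral_eq_lintegral_ofReal
    (integrableOn_normDensity_mul_centeredDensity hM hv hw x)
    ((ae_restrict_mem measurableSet_Ioi).mono fun r hr =>
      mul_nonneg (normDensity_nonneg hv (le_of_lt hr)) (centeredDensity_nonneg _ _)),
    ← lintegral_indicator measurableSet_Ioi]
  refine lintegral_congr fun r => ?_
  by_cases h : r ∈ Set.Ioi (0 : ℝ)
  · rw [Set.indicator_of_mem h, Set.indicator_of_mem h,
      ENNReal.ofReal_mul (normDensity_nonneg hv (le_of_lt h)), neg_add_eq_sub]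
  · rw [Set.indicator_of_notMem h, Set.indicator_of_notMem h, zero_mul]

/-! ### The law of the norm plus a projected Gaussian -/

theorem real_inner_eq_re_complex_inner {M : ℕ} (x y : EuclideanSpace ℂ (Fin M)) :
    inner ℝ x y = (inner ℂ x y : ℂ).re := by
  simp only [PiLp.inner_apply, Complex.re_sum]
  rfl

theorem finrank_real_euclideanSpace_complex (M : ℕ) :
    Module.finrank ℝ (EuclideanSpace ℂ (Fin M)) = 2 * M := by
  rw [← Module.finrank_mul_finrank ℝ ℂ, Complex.finrank_real_complex, finrank_euclideanSpace_fin]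

theorem map_norm_complexGaussianVec {M : ℕ} (hM : 1 ≤ M) {v : ℝ} (hv : 0 < v) :
    (PilotContention.complexGaussianVec M v).map (fun x => ‖x‖) =
      (volume.restrict (Set.Ioi 0)).withDensity (fun r => ENNReal.ofReal (normDensity M v r)) :=
  map_norm_of_charFun hM (finrank_real_euclideanSpace_complex M) hv _
    (charFun_complexGaussianVec M hv.le)

theorem ae_ne_zero_complexGaussianVec {M : ℕ} (hM : 1 ≤ M) {v : ℝ} (hv : 0 < v) :
    ∀ᵐ x ∂PilotContention.complexGaussianVec M v, x ≠ 0 := by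
  have h : ∀ᵐ r ∂(PilotContention.complexGaussianVec M v).map (fun x => ‖x‖), 0 < r := by
    rw [map_norm_complexGaussianVec hM hv]
    exact (withDensity_absolutelyContinuous _ _).ae_le (ae_restrict_mem measurableSet_Ioi)
  exact (ae_of_ae_map (by fun_prop) h).mono fun x hx => norm_pos_iff.1 hx

open Complex in
/-- The law of `‖x‖ + uᴴ x / ‖x‖ + η`. -/
theorem map_norm_add_inner {M : ℕ} (hM : 1 ≤ M) {v w s : ℝ} (hv : 0 < v) (hw : 0 < w)
    (hs : 0 < s) :
    (((PilotContention.complexGaussianVec M v).prod (PilotContention.complexGaussianVec M w)).prod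
        (PilotContention.complexGaussian s)).map
      (fun p => (‖p.1.1‖ : ℂ) + inner ℂ p.1.2 (((‖p.1.1‖⁻¹ : ℝ) : ℂ) • p.1.1) + p.2) =
    (((PilotContention.complexGaussianVec M v).map (fun x => ‖x‖) ∗
        gaussianReal 0 ((s + w) / 2).toNNReal).prod
      (gaussianReal 0 ((s + w) / 2).toNNReal)).map (fun p => (⟨p.1, p.2⟩ : ℂ)) := by
  have hmk : Measurable (fun p : ℝ × ℝ => (⟨p.1, p.2⟩ : ℂ)) :=
    Complex.measurableEquivRealProd.symm.measurable
  have hF : Measurable (fun p : (EuclideanSpace ℂ (Fin M) × EuclideanSpace ℂ (Fin M)) × ℂ =>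
      (‖p.1.1‖ : ℂ) + inner ℂ p.1.2 (((‖p.1.1‖⁻¹ : ℝ) : ℂ) • p.1.1) + p.2) := by
    fun_prop
  have : IsProbabilityMeasure ((PilotContention.complexGaussianVec M v).map (fun x => ‖x‖)) :=
    Measure.isProbabilityMeasure_map (by fun_prop)
  have := Measure.isProbabilityMeasure_map (μ := ((PilotContention.complexGaussianVec M v).prod
    (PilotContention.complexGaussianVec M w)).prod (PilotContention.complexGaussian s))
    hF.aemeasurable
  have := Measure.isProbabilityMeasure_map
    (μ := ((PilotContention.complexGaussianVec M v).map (fun x => ‖x‖) ∗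
        gaussianReal 0 ((s + w) / 2).toNNReal).prod (gaussianReal 0 ((s + w) / 2).toNNReal))
    hmk.aemeasurable
  refine Measure.ext_of_charFun ?_
  ext t
  rw [charFun_apply, charFun_apply, integral_map hF.aemeasurable (by fun_prop),
    integral_map hmk.aemeasurable (by fun_prop)]
  -- the right-hand side
  have hR (p : ℝ × ℝ) : cexp ((inner ℝ (⟨p.1, p.2⟩ : ℂ) t : ℝ) * I) =
      cexp (t.re * p.1 * I) * cexp (t.im * p.2 * I) := by
    rw [← Complex.exp_add, Complex.inner]
    congr 1
    simp
    ring
  simp_rw [hR]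
  rw [integral_prod_mul (fun x : ℝ => cexp (t.re * x * I)) (fun x : ℝ => cexp (t.im * x * I)),
    ← charFun_apply_real, ← charFun_apply_real, charFun_conv, charFun_gaussianReal,
    charFun_gaussianReal, charFun_apply_real, integral_map (by fun_prop) (by fun_prop)]
  -- the left-hand side
  have hL (p : (EuclideanSpace ℂ (Fin M) × EuclideanSpace ℂ (Fin M)) × ℂ) :
      cexp ((inner ℝ ((‖p.1.1‖ : ℂ) + inner ℂ p.1.2 (((‖p.1.1‖⁻¹ : ℝ) : ℂ) • p.1.1) + p.2) t : ℝ)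
        * I) =
      (cexp (t.re * ‖p.1.1‖ * I) *
        cexp ((inner ℝ p.1.2 ((starRingEnd ℂ t * ((‖p.1.1‖⁻¹ : ℝ) : ℂ)) • p.1.1) : ℝ) * I)) *
        cexp ((inner ℝ p.2 t : ℝ) * I) := by
    rw [← Complex.exp_add, ← Complex.exp_add, real_inner_eq_re_complex_inner, inner_add_left,
      inner_add_left, inner_smul_right, inner_smul_right]
    congr 1
    simp only [Complex.inner]
    rw [← add_mul, ← add_mul]
    congr 1
    rw [← ofReal_mul, ← ofReal_add, ← ofReal_add]
    congr 3
    · simp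
    · generalize (inner ℂ p.1.2 p.1.1 : ℂ) = c
      simp
      ring
  have hint : Integrable (fun p : EuclideanSpace ℂ (Fin M) × EuclideanSpace ℂ (Fin M) =>
      cexp (t.re * ‖p.1‖ * I) *
        cexp ((inner ℝ p.2 ((starRingEnd ℂ t * ((‖p.1‖⁻¹ : ℝ) : ℂ)) • p.1) : ℝ) * I))
      ((PilotContention.complexGaussianVec M v).prod (PilotContention.complexGaussianVec M w)) := by
    refine Integrable.of_bound (C := 1) (Measurable.aestronglyMeasurable (by fun_prop))
      (.of_forall fun p => ?_)
    rw [norm_mul, ← ofReal_mul, norm_exp_ofReal_mul_I, norm_exp_ofReal_mul_I, one_mul]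
  simp_rw [hL]
  rw [integral_prod_mul (fun p : EuclideanSpace ℂ (Fin M) × EuclideanSpace ℂ (Fin M) =>
      cexp (t.re * ‖p.1‖ * I) *
        cexp ((inner ℝ p.2 ((starRingEnd ℂ t * ((‖p.1‖⁻¹ : ℝ) : ℂ)) • p.1) : ℝ) * I))
      (fun y : ℂ => cexp ((inner ℝ y t : ℝ) * I)), ← charFun_apply,
    charFun_complexGaussian hs.le, integral_prod _ hint]
  simp_rw [integral_const_mul, ← charFun_apply, charFun_complexGaussianVec M hw.le]
  -- For `x ≠ 0` that point has norm `‖t‖`, so by isotropy the integral over `u` no longer depends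
  -- on `x`.
  have hae : ∀ᵐ x ∂PilotContention.complexGaussianVec M v, cexp (t.re * ‖x‖ * I) *
      cexp (-(w / 4 * ‖(starRingEnd ℂ t * ((‖x‖⁻¹ : ℝ) : ℂ)) • x‖ ^ 2 : ℝ)) =
      cexp (t.re * ‖x‖ * I) * cexp (-(w / 4 * ‖t‖ ^ 2 : ℝ)) := by
    filter_upwards [ae_ne_zero_complexGaussianVec hM hv] with x hx
    have : 0 < ‖x‖ := norm_pos_iff.2 hx
    rw [norm_smul, norm_mul, RCLike.norm_conj, norm_real, Real.norm_of_nonneg (by positivity),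
      inv_mul_cancel_right₀ this.ne']
  rw [integral_congr_ae hae, integral_mul_const, mul_assoc, mul_assoc, ← Complex.exp_add,
    ← Complex.exp_add, Complex.sq_norm, Complex.normSq_apply]
  congr 2
  have : ((((s + w) / 2).toNNReal : ℝ) : ℂ) = (s + w) / 2 := by
    rw [Real.coe_toNNReal _ (by positivity)]; simp
  simp only [this]
  push_cast
  ring

/-! ### Splitting the channel into estimate and independent residual -/

/-- The law of all channels `some i` and of the base station noise `none`. -/
noncomputable def channelNoiseLaw (M : ℕ) {K : ℕ} (σ : ℝ) (β : Fin K → ℝ) :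
    Measure (Option (Fin K) → EuclideanSpace ℂ (Fin M)) :=
  Measure.pi fun o => PilotContention.complexGaussianVec M (o.elim (σ ^ 2) β)

instance isProbabilityMeasure_channelNoiseLaw (M : ℕ) {K : ℕ} (σ : ℝ) (β : Fin K → ℝ) :
    IsProbabilityMeasure (channelNoiseLaw M σ β) := by
  unfold channelNoiseLaw; infer_instance

open Complex in
theorem integral_cexp_sum_inner_channelNoiseLaw (M : ℕ) {K : ℕ} (σ : ℝ) {β : Fin K → ℝ}
    (hβ : ∀ i, 0 < β i) (a : Option (Fin K) → EuclideanSpace ℂ (Fin M)) :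
    ∫ X, cexp ((∑ o, inner ℝ (X o) (a o) : ℝ) * I) ∂channelNoiseLaw M σ β =
      cexp (-((σ ^ 2 * ‖a none‖ ^ 2 + ∑ i, β i * ‖a (some i)‖ ^ 2) / 4 : ℝ)) := by
  have h := charFun_pi (μ := fun o : Option (Fin K) =>
    PilotContention.complexGaussianVec M (o.elim (σ ^ 2) β)) (WithLp.toLp 2 a)
  rw [charFun_apply, integral_map (by fun_prop) (by fun_prop)] at h
  simp only [PiLp.inner_apply] at h
  simp only [PiLp.inner_apply]
  rw [channelNoiseLaw, h, Fintype.prod_option]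
  simp only [Option.elim]
  rw [charFun_complexGaussianVec M (sq_nonneg σ)]
  simp_rw [charFun_complexGaussianVec M (hβ _).le]
  rw [← Complex.exp_sum, ← Complex.exp_add]
  congr 1
  rw [Finset.sum_neg_distrib, ← ofReal_sum, ← neg_add, ← ofReal_add, add_div, Finset.sum_div]
  congr 2
  rw [mul_div_right_comm]
  congr 1
  exact Finset.sum_congr rfl fun i _ => by ring

/-- The signal `∑_{i ∈ S} √ρ h_i + n`, scaled to unit power of the useful component. -/
noncomputable def scaledSignal {M K : ℕ} (ρ c : ℝ) (S : Finset (Fin K))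
    (X : Option (Fin K) → EuclideanSpace ℂ (Fin M)) : EuclideanSpace ℂ (Fin M) :=
  c • (∑ i ∈ S, Real.sqrt ρ • X (some i) + X none)

theorem measurable_scaledSignal {M K : ℕ} (ρ c : ℝ) (S : Finset (Fin K)) :
    Measurable (scaledSignal (M := M) ρ c S) := by
  unfold scaledSignal; fun_prop

/-- Regroups the exponent of the joint characteristic function by independent vectors, so that it
factors. User `k` contributes twice: through the uplink sum and through the residual. -/
theorem inner_scaledSignal_add_inner {M K : ℕ} (ρ c d : ℝ) (S : Finset (Fin K)) (k : Fin K)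
    (X : Option (Fin K) → EuclideanSpace ℂ (Fin M)) (t s : EuclideanSpace ℂ (Fin M)) :
    inner ℝ (scaledSignal ρ c S X) t + inner ℝ (d • X (some k) - scaledSignal ρ c S X) s =
      ∑ o, inner ℝ (X o) (o.elim (c • (t - s)) fun i =>
        (if i ∈ S then Real.sqrt ρ • c • (t - s) else 0) + if i = k then d • s else 0) := by
  rw [Fintype.sum_option]
  simp only [Option.elim, inner_add_right, Finset.sum_add_distrib]
  have h1 : ∑ i, inner ℝ (X (some i)) (if i ∈ S then Real.sqrt ρ • c • (t - s) else 0) =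
      ∑ i ∈ S, inner ℝ (X (some i)) (Real.sqrt ρ • c • (t - s)) := by
    simp [apply_ite, Finset.sum_ite_mem]
  have h2 : ∑ i, inner ℝ (X (some i)) (if i = k then d • s else 0) =
      inner ℝ (X (some k)) (d • s) := by
    simp [apply_ite]
  rw [h1, h2, scaledSignal]
  simp only [inner_smul_left, inner_smul_right, inner_add_left, inner_sub_left, inner_sub_right,
    sum_inner, RCLike.conj_to_real, mul_sub, Finset.sum_sub_distrib]
  simp only [mul_left_comm, mul_add, Finset.mul_sum]
  ring

/-- The constant `c` is the covariance of `√q h_k` and `y` over the variance of `y`, which makes the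
residual uncorrelated with the estimate; for Gaussian vectors this shows up as a factored joint
characteristic function. -/
theorem map_scaledSignal_residual {M K : ℕ} {ρ q σ : ℝ} (hρ : 0 < ρ) (hq : 0 < q) (hσ : 0 < σ)
    {β : Fin K → ℝ} (hβ : ∀ i, 0 < β i) {S : Finset (Fin K)} {k : Fin K} (hk : k ∈ S)
    {c l w : ℝ} (hc : c = Real.sqrt q * (Real.sqrt ρ * β k / (ρ * ∑ i ∈ S, β i + σ ^ 2)))
    (hl : l = PilotContention.lam1 ρ q σ (β k) (∑ i ∈ S, β i)) (hw : w = q * β k - l)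
    (hl0 : 0 < l) (hw0 : 0 < w) :
    (channelNoiseLaw M σ β).map (fun X =>
      (scaledSignal ρ c S X, Real.sqrt q • X (some k) - scaledSignal ρ c S X)) =
    (PilotContention.complexGaussianVec M l).prod (PilotContention.complexGaussianVec M w) := by
  have hm := measurable_scaledSignal (M := M) ρ c S
  have hmeas : Measurable (fun X : Option (Fin K) → EuclideanSpace ℂ (Fin M) =>
      (scaledSignal ρ c S X, Real.sqrt q • X (some k) - scaledSignal ρ c S X)) :=
    hm.prodMk (Measurable.sub (by fun_prop) hm)
  have := Measure.isProbabilityMeasure_map (μ := channelNoiseLaw M σ β) hmeas.aemeasurable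
  rw [← charFun_eq_prod_iff]
  intro t
  rw [charFun_apply, integral_map (by fun_prop) (by fun_prop),
    integral_map hmeas.aemeasurable (by fun_prop)]
  simp only [WithLp.prod_inner_apply]
  simp_rw [inner_scaledSignal_add_inner]
  rw [integral_cexp_sum_inner_channelNoiseLaw M σ hβ, charFun_complexGaussianVec M hl0.le,
    charFun_complexGaussianVec M hw0.le, ← Complex.exp_add, ← neg_add, ← Complex.ofReal_add]
  congr 3
  generalize t.ofLp.1 = t₁
  generalize t.ofLp.2 = t₂
  simp only [Option.elim]
  set a := c • (t₁ - t₂) with ha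
  set b := Real.sqrt q • t₂ with hb
  have hsum (i : Fin K) :
      β i * ‖(if i ∈ S then Real.sqrt ρ • a else 0) + (if i = k then b else 0)‖ ^ 2 =
      (if i ∈ S then β i * (ρ * ‖a‖ ^ 2) else 0) +
        if i = k then β k * (2 * Real.sqrt ρ * inner ℝ a b + ‖b‖ ^ 2) else 0 := by
    by_cases hik : i = k
    · subst hik
      simp only [hk, if_true]
      rw [norm_add_sq_real, norm_smul, inner_smul_left, mul_pow, Real.norm_eq_abs, sq_abs,
        Real.sq_sqrt hρ.le, RCLike.conj_to_real]
      ring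
    · by_cases hi : i ∈ S
      · simp only [hi, hik, if_true, if_false, add_zero]
        rw [norm_smul, mul_pow, Real.norm_eq_abs, sq_abs, Real.sq_sqrt hρ.le]
      · simp [hi, hik]
  simp_rw [hsum]
  rw [Finset.sum_add_distrib, Finset.sum_ite_mem, Finset.univ_inter, ← Finset.sum_mul,
    Finset.sum_ite_eq' Finset.univ k, if_pos (Finset.mem_univ k)]
  have hα : 0 < ∑ i ∈ S, β i := Finset.sum_pos (fun i _ => hβ i) ⟨k, hk⟩
  generalize ∑ i ∈ S, β i = α at *
  have hna : ‖a‖ ^ 2 = c ^ 2 * (‖t₁‖ ^ 2 - 2 * inner ℝ t₁ t₂ + ‖t₂‖ ^ 2) := by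
    rw [ha, norm_smul, mul_pow, Real.norm_eq_abs, sq_abs, norm_sub_sq_real]
  have hnb : ‖b‖ ^ 2 = q * ‖t₂‖ ^ 2 := by
    rw [hb, norm_smul, mul_pow, Real.norm_eq_abs, sq_abs, Real.sq_sqrt hq.le]
  have hab : inner ℝ a b = c * Real.sqrt q * (inner ℝ t₁ t₂ - ‖t₂‖ ^ 2) := by
    rw [ha, hb, inner_smul_left, inner_smul_right, inner_sub_left, real_inner_self_eq_norm_sq,
      RCLike.conj_to_real]
    ring
  have hD : 0 < ρ * α + σ ^ 2 := by positivity
  have hsq := Real.sq_sqrt hq.le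
  have hsρ := Real.sq_sqrt hρ.le
  -- The variance of the estimate (`h1`) and its covariance with `√q h_k` (`h2`) are both `l`; their
  -- equality cancels the cross term in `⟪t₁, t₂⟫`.
  have h1 : (ρ * α + σ ^ 2) * c ^ 2 = l := by
    rw [hc, hl, PilotContention.lam1, mul_pow, div_pow, mul_pow, hsq, hsρ]
    field_simp
  have h2 : β k * (Real.sqrt ρ * (c * Real.sqrt q)) = l := by
    rw [hl, PilotContention.lam1, hc]
    field_simp
    rw [hsq, hsρ]
  rw [hna, hnb, hab, hw]
  linear_combination (‖t₁‖ ^ 2 - 2 * inner ℝ t₁ t₂ + ‖t₂‖ ^ 2) / 4 * h1 +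
    (inner ℝ t₁ t₂ - ‖t₂‖ ^ 2) / 2 * h2

/-- Positive rescaling does not change the direction, and `xᴴ x / ‖x‖ = ‖x‖`. With `0⁻¹ = 0` the
identity holds everywhere, including at `x = 0`. -/
theorem receivedSignal_eq {M K : ℕ} {ρ q c : ℝ} (hρ : 0 < ρ) (hq : 0 < q) (hc : 0 < c)
    (S : Finset (Fin K)) (k : Fin K) (X : Option (Fin K) → EuclideanSpace ℂ (Fin M)) (η : ℂ) :
    PilotContention.receivedSignal ρ q S k (fun i => X (some i)) (X none) η =
      (‖scaledSignal ρ c S X‖ : ℂ) +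
        inner ℂ (Real.sqrt q • X (some k) - scaledSignal ρ c S X)
          (((‖scaledSignal ρ c S X‖⁻¹ : ℝ) : ℂ) • scaledSignal ρ c S X) + η := by
  set x := scaledSignal ρ c S X with hx
  have hρ' := Real.sqrt_pos.2 hρ
  have hls : PilotContention.lsEstimate ρ S (fun i => X (some i)) (X none) =
      (1 / Real.sqrt ρ * c⁻¹) • x := by
    rw [PilotContention.lsEstimate, PilotContention.uplinkSignal, hx, scaledSignal, smul_smul,
      mul_assoc, inv_mul_cancel₀ hc.ne', mul_one]
    simp only [Complex.coe_smul]
  have hpre : PilotContention.precoder ρ q S (fun i => X (some i)) (X none) =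
      (Real.sqrt q * ‖x‖⁻¹) • x := by
    rw [PilotContention.precoder, hls, norm_smul, Real.norm_of_nonneg (by positivity),
      Complex.coe_smul, smul_smul]
    congr 1
    rw [div_eq_mul_inv, mul_inv]
    field_simp
  rw [PilotContention.receivedSignal, hpre]
  congr 1
  have hxx : (‖x‖ : ℂ) = inner ℂ x (((‖x‖⁻¹ : ℝ) : ℂ) • x) := by
    rw [inner_smul_right, inner_self_eq_norm_sq_to_K]
    rcases eq_or_ne x 0 with h | h
    · simp [h]
    · have : (‖x‖ : ℂ) ≠ 0 := by simpa using h
      push_cast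
      field_simp
      rfl
  rw [inner_sub_left, hxx, add_sub_cancel, ← Complex.coe_smul, ← Complex.coe_smul,
    inner_smul_right, inner_smul_right, inner_smul_left, Complex.conj_ofReal]
  push_cast
  ring

theorem lam1_pos {ρ q σ b α : ℝ} (hρ : 0 < ρ) (hq : 0 < q) (hσ : 0 < σ) (hb : 0 < b)
    (hα : b ≤ α) : 0 < PilotContention.lam1 ρ q σ b α := by
  have : 0 < α := hb.trans_le hα
  rw [PilotContention.lam1]; positivity

/-- Makes the residual variance `q b - λ₁` positive; the reason is `ρ b < ρ α + σ²`. -/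
theorem lam1_lt {ρ q σ b α : ℝ} (hρ : 0 < ρ) (hq : 0 < q) (hσ : 0 < σ) (hb : 0 < b)
    (hα : b ≤ α) : PilotContention.lam1 ρ q σ b α < q * b := by
  have : 0 < α := hb.trans_le hα
  rw [PilotContention.lam1, div_lt_iff₀ (by positivity)]
  have h1 : q * b * (ρ * b) ≤ q * b * (ρ * α) := by gcongr
  have h2 : 0 < q * b * σ ^ 2 := by positivity
  nlinarith

theorem hasLaw_channels_noise {Ω : Type*} [MeasurableSpace Ω] {P : Measure Ω} {M K : ℕ} {σ : ℝ}
    {β : Fin K → ℝ} {h : Fin K → Ω → EuclideanSpace ℂ (Fin M)}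
    {n : Ω → EuclideanSpace ℂ (Fin M)} {η : Ω → ℂ}
    (H : PilotContention.IsRayleighModel P σ β h n η) :
    HasLaw (fun ω => ((fun o : Option (Fin K) => o.elim (n ω) (fun i => h i ω)), η ω))
      ((channelNoiseLaw M σ β).prod (PilotContention.complexGaussian (σ ^ 2))) P := by
  have hP : IsProbabilityMeasure P := H.law_userNoise.isProbabilityMeasure
  have h1 : HasLaw (fun ω (o : Option (Fin K)) => (o.elim n h) ω) (channelNoiseLaw M σ β) P :=
    H.indep_channels_noise.hasLaw_pi fun o => by
      cases o with
      | none => exact H.law_noise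
      | some i => exact H.law_channel i
  have e : (fun ω (o : Option (Fin K)) => (o.elim n h) ω) =
      fun ω (o : Option (Fin K)) => o.elim (n ω) (fun i => h i ω) := by
    ext ω o : 2
    cases o <;> rfl
  rw [e] at h1
  have hmeas : Measurable (fun (p : (Fin K → EuclideanSpace ℂ (Fin M)) × EuclideanSpace ℂ (Fin M))
      (o : Option (Fin K)) => o.elim p.2 p.1) := by
    refine measurable_pi_lambda _ fun o => ?_
    cases o with
    | none => exact measurable_snd
    | some i => exact (measurable_pi_apply i).comp measurable_fst
  have h2 := H.indep_userNoise.comp hmeas measurable_id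
  exact IndepFun.hasLaw_prod h1 H.law_userNoise h2

/-! ### Continuous densities and their uniqueness -/

theorem isContinuousPDF_f2 {ρ q σ b α : ℝ} (h₂ : 0 < PilotContention.lam2 ρ q σ b α) :
    PilotContention.IsContinuousPDF (gaussianReal 0 (PilotContention.lam2 ρ q σ b α / 2).toNNReal)
      (fun y => PilotContention.f2 ρ q σ b y α) :=
  ⟨continuous_centeredDensity _, centeredDensity_nonneg _,
    gaussianReal_eq_withDensity_centeredDensity h₂⟩

/-- Continuity and nonnegativity are hidden in the closed form, where `signCoeff` jumps at `0`; they
are read off the convolution integral instead. -/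
theorem isContinuousPDF_f1 {M : ℕ} (hM : 1 ≤ M) {ρ q σ b α : ℝ}
    (h₁ : 0 < PilotContention.lam1 ρ q σ b α) (h₂ : 0 < PilotContention.lam2 ρ q σ b α) :
    PilotContention.IsContinuousPDF
      ((PilotContention.complexGaussianVec M (PilotContention.lam1 ρ q σ b α)).map
        (fun x => ‖x‖) ∗ gaussianReal 0 (PilotContention.lam2 ρ q σ b α / 2).toNNReal)
      (fun x => PilotContention.f1 M ρ q σ b x α) := by
  simp_rw [← integral_normDensity_mul_eq_f1 hM h₁ h₂]
  refine ⟨continuous_integral_normDensity_mul hM h₁ h₂, integral_normDensity_mul_nonneg h₁, ?_⟩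
  rw [map_norm_complexGaussianVec hM h₁, normDensity_conv_gaussianReal hM h₁ h₂]

theorem PilotContention.IsContinuousPDF.prod {μ ν : Measure ℝ} [SFinite μ] [SFinite ν]
    {f g : ℝ → ℝ} (hf : PilotContention.IsContinuousPDF μ f)
    (hg : PilotContention.IsContinuousPDF ν g) :
    PilotContention.IsContinuousPDF (μ.prod ν) (fun p => f p.1 * g p.2) := by
  refine ⟨(hf.1.comp continuous_fst).mul (hg.1.comp continuous_snd),
    fun p => mul_nonneg (hf.2.1 _) (hg.2.1 _), ?_⟩
  rw [hf.2.2, hg.2.2, prod_withDensity hf.1.measurable.ennreal_ofReal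
    hg.1.measurable.ennreal_ofReal]
  simp_rw [ENNReal.ofReal_mul (hf.2.1 _)]
  rfl

/-- Two densities agree almost everywhere, and continuous functions that agree almost everywhere are
equal when open sets have positive measure. Pointwise likelihood values are thus well defined. -/
theorem PilotContention.IsContinuousPDF.unique {E : Type*} [MeasureSpace E]
    [TopologicalSpace E] [OpensMeasurableSpace E] [(volume : Measure E).IsOpenPosMeasure]
    [SigmaFinite (volume : Measure E)] {μ : Measure E} {f g : E → ℝ}
    (hf : PilotContention.IsContinuousPDF μ f) (hg : PilotContention.IsContinuousPDF μ g) :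
    f = g := by
  have h := (withDensity_eq_iff_of_sigmaFinite hf.1.measurable.ennreal_ofReal.aemeasurable
    hg.1.measurable.ennreal_ofReal.aemeasurable).1 (hf.2.2.symm.trans hg.2.2)
  refine (hf.1.ae_eq_iff_eq volume hg.1).1 (h.mono fun x hx => ?_)
  exact (ENNReal.ofReal_eq_ofReal_iff (hf.2.1 x) (hg.2.1 x)).1 hx

/-! ### The law of the received signal -/

section Signal

variable {M K : ℕ} {ρ q σ : ℝ} {β : Fin K → ℝ} {S : Finset (Fin K)} {k : Fin K}

theorem map_receivedSignal (hM : 1 ≤ M) (hρ : 0 < ρ) (hq : 0 < q) (hσ : 0 < σ)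
    (hβ : ∀ i, 0 < β i) (hk : k ∈ S)
    {Ω : Type*} [MeasurableSpace Ω] {P : Measure Ω}
    {h : Fin K → Ω → EuclideanSpace ℂ (Fin M)} {n : Ω → EuclideanSpace ℂ (Fin M)} {η : Ω → ℂ}
    (H : PilotContention.IsRayleighModel P σ β h n η) :
    HasLaw (fun ω => ((PilotContention.receivedSignal ρ q S k (fun i => h i ω) (n ω) (η ω)).re,
        (PilotContention.receivedSignal ρ q S k (fun i => h i ω) (n ω) (η ω)).im))
      (((PilotContention.complexGaussianVec M
        (PilotContention.lam1 ρ q σ (β k) (∑ i ∈ S, β i))).map (fun x => ‖x‖) ∗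
        gaussianReal 0 (PilotContention.lam2 ρ q σ (β k) (∑ i ∈ S, β i) / 2).toNNReal).prod
        (gaussianReal 0 (PilotContention.lam2 ρ q σ (β k) (∑ i ∈ S, β i) / 2).toNNReal)) P := by
  have hα : β k ≤ ∑ i ∈ S, β i := Finset.single_le_sum (fun i _ => (hβ i).le) hk
  have hα0 : 0 < ∑ i ∈ S, β i := (hβ k).trans_le hα
  have hl0 := lam1_pos hρ hq hσ (hβ k) hα
  have hw0 := sub_pos.2 (lam1_lt hρ hq hσ (hβ k) hα)
  set c := Real.sqrt q * (Real.sqrt ρ * β k / (ρ * ∑ i ∈ S, β i + σ ^ 2)) with hc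
  have hc0 : 0 < c := by
    have := hβ k
    have := Real.sqrt_pos.2 hρ
    have := Real.sqrt_pos.2 hq
    positivity
  have hXu := map_scaledSignal_residual (M := M) hρ hq hσ hβ hk hc rfl rfl hl0 hw0
  set l := PilotContention.lam1 ρ q σ (β k) (∑ i ∈ S, β i) with hl
  have hm := measurable_scaledSignal (M := M) ρ c S
  have hmeas : Measurable (fun X : Option (Fin K) → EuclideanSpace ℂ (Fin M) =>
      (scaledSignal ρ c S X, Real.sqrt q • X (some k) - scaledSignal ρ c S X)) :=
    hm.prodMk (Measurable.sub (by fun_prop) hm)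
  have hF : Measurable (fun p : (EuclideanSpace ℂ (Fin M) × EuclideanSpace ℂ (Fin M)) × ℂ =>
      (‖p.1.1‖ : ℂ) + inner ℂ p.1.2 (((‖p.1.1‖⁻¹ : ℝ) : ℂ) • p.1.1) + p.2) := by
    fun_prop
  have hpair : HasLaw (fun p : (Option (Fin K) → EuclideanSpace ℂ (Fin M)) × ℂ =>
      ((scaledSignal ρ c S p.1, Real.sqrt q • p.1 (some k) - scaledSignal ρ c S p.1), p.2))
      (((PilotContention.complexGaussianVec M l).prod
        (PilotContention.complexGaussianVec M (q * β k - l))).prod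
        (PilotContention.complexGaussian (σ ^ 2)))
      ((channelNoiseLaw M σ β).prod (PilotContention.complexGaussian (σ ^ 2))) := by
    refine ⟨((hmeas.comp measurable_fst).prodMk measurable_snd).aemeasurable, ?_⟩
    have := Measure.map_prod_map (channelNoiseLaw M σ β) (PilotContention.complexGaussian (σ ^ 2))
      hmeas measurable_id
    rw [hXu, Measure.map_id] at this
    exact this.symm
  have hz : HasLaw (fun p : (EuclideanSpace ℂ (Fin M) × EuclideanSpace ℂ (Fin M)) × ℂ =>
      (‖p.1.1‖ : ℂ) + inner ℂ p.1.2 (((‖p.1.1‖⁻¹ : ℝ) : ℂ) • p.1.1) + p.2) _ _ :=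
    ⟨hF.aemeasurable, map_norm_add_inner hM hl0 hw0 (pow_pos hσ 2)⟩
  have hsplit : HasLaw (fun z : ℂ => (z.re, z.im))
      (((PilotContention.complexGaussianVec M l).map (fun x => ‖x‖) ∗
        gaussianReal 0 ((σ ^ 2 + (q * β k - l)) / 2).toNNReal).prod
      (gaussianReal 0 ((σ ^ 2 + (q * β k - l)) / 2).toNNReal))
      ((((PilotContention.complexGaussianVec M l).map (fun x => ‖x‖) ∗
        gaussianReal 0 ((σ ^ 2 + (q * β k - l)) / 2).toNNReal).prod
      (gaussianReal 0 ((σ ^ 2 + (q * β k - l)) / 2).toNNReal)).map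
        (fun p => (⟨p.1, p.2⟩ : ℂ))) := by
    refine ⟨(Complex.measurable_re.prodMk Complex.measurable_im).aemeasurable, ?_⟩
    have hmk : Measurable (fun p : ℝ × ℝ => (⟨p.1, p.2⟩ : ℂ)) :=
      Complex.measurableEquivRealProd.symm.measurable
    rw [Measure.map_map (Complex.measurable_re.prodMk Complex.measurable_im) hmk]
    exact Measure.map_id
  -- `λ₂` is the user noise variance plus the residual variance.
  have hl2 : PilotContention.lam2 ρ q σ (β k) (∑ i ∈ S, β i) = σ ^ 2 + (q * β k - l) := by
    rw [PilotContention.lam2]; ring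
  rw [hl2]
  refine ((hsplit.fun_comp (hz.fun_comp hpair)).fun_comp (hasLaw_channels_noise H)).congr
    (.of_forall fun ω => ?_)
  have hω := receivedSignal_eq hρ hq hc0 S k
    (fun o : Option (Fin K) => o.elim (n ω) (fun i => h i ω)) (η ω)
  simp only [Option.elim] at hω ⊢
  rw [hω]

theorem isContinuousPDF_receivedSignal (hM : 1 ≤ M) (hρ : 0 < ρ) (hq : 0 < q) (hσ : 0 < σ)
    (hβ : ∀ i, 0 < β i) (hk : k ∈ S)
    {Ω : Type*} [MeasurableSpace Ω] {P : Measure Ω}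
    {h : Fin K → Ω → EuclideanSpace ℂ (Fin M)} {n : Ω → EuclideanSpace ℂ (Fin M)} {η : Ω → ℂ}
    (H : PilotContention.IsRayleighModel P σ β h n η) {z : Ω → ℂ}
    (hz : z = fun ω => PilotContention.receivedSignal ρ q S k (fun i => h i ω) (n ω) (η ω)) :
    PilotContention.IsContinuousPDF (P.map (fun ω => (z ω).re))
      (fun x => PilotContention.f1 M ρ q σ (β k) x (∑ i ∈ S, β i)) ∧
    PilotContention.IsContinuousPDF (P.map (fun ω => (z ω).im))
      (fun y => PilotContention.f2 ρ q σ (β k) y (∑ i ∈ S, β i)) ∧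
    PilotContention.IsContinuousPDF (P.map (fun ω => ((z ω).re, (z ω).im)))
      (fun p => PilotContention.f1 M ρ q σ (β k) p.1 (∑ i ∈ S, β i) *
        PilotContention.f2 ρ q σ (β k) p.2 (∑ i ∈ S, β i)) := by
  subst hz
  have hα : β k ≤ ∑ i ∈ S, β i := Finset.single_le_sum (fun i _ => (hβ i).le) hk
  have h₁ := lam1_pos hρ hq hσ (hβ k) hα
  have h₂ : 0 < PilotContention.lam2 ρ q σ (β k) (∑ i ∈ S, β i) := by
    have := lam1_lt hρ hq hσ (hβ k) hα
    have := pow_pos hσ 2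
    rw [PilotContention.lam2]; linarith
  have hlaw := map_receivedSignal hM hρ hq hσ hβ hk H
  have : IsProbabilityMeasure ((PilotContention.complexGaussianVec M
      (PilotContention.lam1 ρ q σ (β k) (∑ i ∈ S, β i))).map (fun x => ‖x‖)) :=
    Measure.isProbabilityMeasure_map (by fun_prop)
  have hfst := measurePreserving_fst.fun_comp_hasLaw hlaw
  have hsnd := measurePreserving_snd.fun_comp_hasLaw hlaw
  refine ⟨?_, ?_, ?_⟩
  · rw [hfst.map_eq]
    exact isContinuousPDF_f1 hM h₁ h₂
  · rw [hsnd.map_eq]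
    exact isContinuousPDF_f2 h₂
  · rw [hlaw.map_eq]
    exact (isContinuousPDF_f1 hM h₁ h₂).prod (isContinuousPDF_f2 h₂)

/-- The product space underlying `signalLaw` carries the model, so the result for an arbitrary
probability space applies to it. -/
theorem isRayleighModel_prod (M : ℕ) (σ : ℝ) (β : Fin K → ℝ) :
    PilotContention.IsRayleighModel
      (((Measure.pi (fun i => PilotContention.complexGaussianVec M (β i))).prod
        (PilotContention.complexGaussianVec M (σ ^ 2))).prod
        (PilotContention.complexGaussian (σ ^ 2)))
      σ β (fun i p => p.1.1 i) (fun p => p.1.2) (fun p => p.2) := by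
  have hch (i : Fin K) : HasLaw (fun p : ((Fin K → EuclideanSpace ℂ (Fin M)) ×
      EuclideanSpace ℂ (Fin M)) × ℂ => p.1.1 i) (PilotContention.complexGaussianVec M (β i))
      (((Measure.pi (fun i => PilotContention.complexGaussianVec M (β i))).prod
        (PilotContention.complexGaussianVec M (σ ^ 2))).prod
        (PilotContention.complexGaussian (σ ^ 2))) :=
    ((measurePreserving_eval (fun i => PilotContention.complexGaussianVec M (β i)) i).comp
      (measurePreserving_fst.comp measurePreserving_fst)).hasLaw
  have hno : HasLaw (fun p : ((Fin K → EuclideanSpace ℂ (Fin M)) ×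
      EuclideanSpace ℂ (Fin M)) × ℂ => p.1.2) (PilotContention.complexGaussianVec M (σ ^ 2))
      (((Measure.pi (fun i => PilotContention.complexGaussianVec M (β i))).prod
        (PilotContention.complexGaussianVec M (σ ^ 2))).prod
        (PilotContention.complexGaussian (σ ^ 2))) :=
    (measurePreserving_snd.comp measurePreserving_fst).hasLaw
  refine ⟨hch, hno, measurePreserving_snd.hasLaw, ?_, ?_⟩
  · have hX (o : Option (Fin K)) : HasLaw (o.elim (fun p : ((Fin K → EuclideanSpace ℂ (Fin M)) ×
        EuclideanSpace ℂ (Fin M)) × ℂ => p.1.2) (fun i p => p.1.1 i))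
        (PilotContention.complexGaussianVec M (o.elim (σ ^ 2) β))
        (((Measure.pi (fun i => PilotContention.complexGaussianVec M (β i))).prod
          (PilotContention.complexGaussianVec M (σ ^ 2))).prod
          (PilotContention.complexGaussian (σ ^ 2))) := by
      cases o with
      | none => exact hno
      | some i => exact hch i
    have hmeas (o : Option (Fin K)) : Measurable (o.elim (fun p : ((Fin K →
        EuclideanSpace ℂ (Fin M)) × EuclideanSpace ℂ (Fin M)) × ℂ => p.1.2)
        (fun i p => p.1.1 i)) := by
      cases o with
      | none => exact measurable_snd.comp measurable_fst
      | some i => exact (measurable_pi_apply i).comp (measurable_fst.comp measurable_fst)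
    refine (iIndepFun_iff_hasLaw_pi_pi hX).2 ⟨(measurable_pi_lambda _ hmeas).aemeasurable, ?_⟩
    refine (Measure.pi_eq fun s hs => ?_).symm
    rw [Measure.map_apply (measurable_pi_lambda _ hmeas) (.univ_pi hs)]
    have hset : (fun (p : ((Fin K → EuclideanSpace ℂ (Fin M)) × EuclideanSpace ℂ (Fin M)) × ℂ)
        (o : Option (Fin K)) => o.elim (fun p : ((Fin K → EuclideanSpace ℂ (Fin M)) ×
          EuclideanSpace ℂ (Fin M)) × ℂ => p.1.2) (fun i p => p.1.1 i) p) ⁻¹'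
          Set.univ.pi s =
        ((Set.univ.pi fun i => s (some i)) ×ˢ s none) ×ˢ Set.univ := by
      ext p
      simp only [Set.mem_preimage, Set.mem_univ_pi, Option.forall, Set.mem_prod, Set.mem_univ,
        and_true, Option.elim]
      exact and_comm
    rw [hset, Measure.prod_prod, Measure.prod_prod, Measure.pi_pi, measure_univ, mul_one,
      Fintype.prod_option, mul_comm]
    rfl
  · exact indepFun_prod measurable_id measurable_id

theorem isContinuousPDF_signalLaw (hM : 1 ≤ M) (hρ : 0 < ρ) (hq : 0 < q) (hσ : 0 < σ)
    (hβ : ∀ i, 0 < β i) (hk : k ∈ S) :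
    PilotContention.IsContinuousPDF (PilotContention.signalLaw M ρ q σ β S k)
      (fun p => PilotContention.f1 M ρ q σ (β k) p.1 (∑ i ∈ S, β i) *
        PilotContention.f2 ρ q σ (β k) p.2 (∑ i ∈ S, β i)) :=
  (isContinuousPDF_receivedSignal hM hρ hq hσ hβ hk (isRayleighModel_prod M σ β) rfl).2.2

end Signal

/-! ### The maximum likelihood estimate -/

theorem isLikelihood_f1_mul_f2 {M : ℕ} (hM : 1 ≤ M) {ρ q σ : ℝ} (hρ : 0 < ρ) (hq : 0 < q)
    (hσ : 0 < σ) (b : ℝ) :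
    PilotContention.IsLikelihood M ρ q σ b (fun α p =>
      PilotContention.f1 M ρ q σ b p.1 α * PilotContention.f2 ρ q σ b p.2 α) := by
  rintro K β S k hβ hk rfl
  exact isContinuousPDF_signalLaw hM hρ hq hσ hβ hk

/-- Every value at least `b` is the sum of the gains of users including one of gain `b`. -/
theorem exists_gains {b α : ℝ} (hb : 0 < b) (hα : b ≤ α) :
    ∃ (K : ℕ) (β : Fin K → ℝ) (S : Finset (Fin K)) (k : Fin K),
      (∀ i, 0 < β i) ∧ k ∈ S ∧ β k = b ∧ ∑ i ∈ S, β i = α := by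
  rcases hα.eq_or_lt with rfl | h
  · exact ⟨1, fun _ => b, Finset.univ, 0, fun _ => hb, Finset.mem_univ _, rfl, by simp⟩
  · refine ⟨2, ![b, α - b], Finset.univ, 0, fun i => ?_, Finset.mem_univ _, rfl, by simp⟩
    fin_cases i
    · exact hb
    · exact sub_pos.2 h

/-- A likelihood is only constrained at attainable gain sums. Those are all `α ≥ b`, and there
uniqueness of the continuous density fixes its value. -/
theorem PilotContention.IsLikelihood.eq {M : ℕ} (hM : 1 ≤ M) {ρ q σ b : ℝ} (hρ : 0 < ρ)
    (hq : 0 < q) (hσ : 0 < σ) (hb : 0 < b) {L : ℝ → ℝ × ℝ → ℝ}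
    (hL : PilotContention.IsLikelihood M ρ q σ b L) {α : ℝ} (hα : b ≤ α) (p : ℝ × ℝ) :
    L α p = PilotContention.f1 M ρ q σ b p.1 α * PilotContention.f2 ρ q σ b p.2 α := by
  obtain ⟨K, β, S, k, hβ, hk, hkb, hsum⟩ := exists_gains hb hα
  have h1 := hL K β S k hβ hk hkb
  have h2 := isLikelihood_f1_mul_f2 hM hρ hq hσ b K β S k hβ hk hkb
  rw [hsum] at h1 h2
  exact congrFun (h1.unique h2) p

theorem theorem1 (M : ℕ) (hM : 1 ≤ M) (ρ q σ : ℝ) (hρ : 0 < ρ) (hq : 0 < q) (hσ : 0 < σ) :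
    -- the conditional PDFs of the real part, the imaginary part, and of both jointly
    (∀ (K : ℕ) (β : Fin K → ℝ) (S : Finset (Fin K)) (k : Fin K),
      (∀ i, 0 < β i) → k ∈ S →
      ∀ (Ω : Type*) [MeasurableSpace Ω] (P : Measure Ω)
        (h : Fin K → Ω → EuclideanSpace ℂ (Fin M)) (n : Ω → EuclideanSpace ℂ (Fin M))
        (η : Ω → ℂ), PilotContention.IsRayleighModel P σ β h n η →
      ∀ z : Ω → ℂ,
        (z = fun ω => PilotContention.receivedSignal ρ q S k (fun i => h i ω) (n ω) (η ω)) →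
        PilotContention.IsContinuousPDF (P.map (fun ω => (z ω).re))
          (fun x => PilotContention.f1 M ρ q σ (β k) x (∑ i ∈ S, β i)) ∧
        PilotContention.IsContinuousPDF (P.map (fun ω => (z ω).im))
          (fun y => PilotContention.f2 ρ q σ (β k) y (∑ i ∈ S, β i)) ∧
        PilotContention.IsContinuousPDF (P.map (fun ω => ((z ω).re, (z ω).im)))
          (fun p => PilotContention.f1 M ρ q σ (β k) p.1 (∑ i ∈ S, β i) *
            PilotContention.f2 ρ q σ (β k) p.2 (∑ i ∈ S, β i))) ∧
    -- the maximum likelihood estimate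
    (∀ b : ℝ, 0 < b → ∀ z : ℂ,
      PilotContention.mlEstimates M ρ q σ b z =
        PilotContention.argmaxOn (Set.Ici b)
          (fun α => PilotContention.f1 M ρ q σ b z.re α * PilotContention.f2 ρ q σ b z.im α)) := by
  refine ⟨fun K β S k hβ hk Ω _ P h n η H z hz =>
    isContinuousPDF_receivedSignal hM hρ hq hσ hβ hk H hz, fun b hb z => ?_⟩
  ext a
  constructor
  · rintro ⟨L, hL, ha, hmax⟩
    refine ⟨ha, fun α hα => ?_⟩
    have := hmax hα
    simp only [Set.mem_ofPred_eq, hL.eq hM hρ hq hσ hb hα, hL.eq hM hρ hq hσ hb ha] at this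
    exact this
  · intro ha
    exact ⟨_, isLikelihood_f1_mul_f2 hM hρ hq hσ b, ha⟩
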